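/- Let $S$ be a Polish space with its Borel $\sigma$-algebra, $\mathcal P(S)$ the Borel probability measures on $S$ and $C_b(S)$ the bounded continuous functions $S\to\mathbb R$. Let $c:S\times S\to[0,\infty]$ be symmetric and such that (i) there is a nonempty $Q\subset C_b(S)$ with $c(x,y)=\sup_{u\in Q}(u(x)-u(y))$ for all $x,y\in S$; (ii) $\Gamma_0:=\{f\in C_b(S): f(x)-f(y)\le c(x,y)\ \text{for all }x,y\in S\}$ is measure determining: for $\mu\neq\nu$ in $\mathcal P(S)$ there is $f\in\Gamma_0$ with $\int f\,d\mu\ne\int f\,d\nu$; (iii) there is $a:S\to[0,\infty)$ with $c(x,y)\le a(x)+a(y)$ for all $x,y\in S$. For $\Gamma\subset C_b(S)$, $b>0$ and $\mu,\nu,\gamma\in\mathcal P(S)$ put $b\Gamma=\{bf:f\in\Gamma\}$, $$G_\Gamma(\mu\|\nu)=\sup_{g\in\Gamma}\Big\{\int_S g\,d\mu-\log\int_S e^g\,d\nu\Big\},\qquad W_\Gamma(\mu,\gamma)=\sup_{g\in\Gamma}\Big\{\int_S g\,d\mu-\int_S g\,d\gamma\Big\},$$ and let $R(\gamma\|\nu)=\int_S\log\frac{d\gamma}{d\nu}\,d\gamma$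 if $\gamma\ll\nu$ and $R(\gamma\|\nu)=\infty$ otherwise. **Theorem.** Let $\mu,\nu\in\mathcal P(S)$ have finite supports $\mathrm{supp}(\nu)=\{x_1,\dots,x_N\}$ and $\mathrm{supp}(\mu)=\{y_1,\dots,y_M\}$ (with the $x_i$ pairwise distinct and the $y_j$ pairwise distinct). Then there is $\gamma^*\in\mathcal P(S)$ with $\gamma^*\ll\nu$, $W_{\Gamma_0}(\mu,\gamma^*)<\infty$ and $R(\gamma^*\|\nu)<\infty$ such that the following hold. 1. For all $b>0$, $$G_{b\Gamma_0}(\mu\|\nu)=b\,W_{\Gamma_0}(\mu,\gamma^*)+R(\gamma^*\|\nu)+r(b),$$ where $r(b)\le 0$ for all $b>0$ and $r(b)\to0$ as $b\to\infty$. 2. $\gamma^*$ is the unique minimizer of $R(\cdot\|\nu)$ over the set of all $\gamma\in\mathcal P(S)$ with $$W_{\Gamma_0}(\mu,\gamma)=\inf_{\theta\in\mathcal P(S),\,\theta\ll\nu}W_{\Gamma_0}(\mu,\theta).$$ 3. If $c(y_j,x_i)\ne c(y_j,x_l)$ for all $1\le j\le M$ and $1\le i\ne l\le N$, then for $1\le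 i\le N$ $$\gamma^*(\{x_i\})=\sum_{j\in S_i}\mu(\{y_j\}),\qquad S_i=\{j: c(y_j,x_i)\le c(y_j,x_l)\ \text{for all }1\le l\le N\}.$$ -/

import Mathlib

open MeasureTheory Filter Topology
open scoped ENNReal NNReal BoundedContinuousFunction Pointwise

section GammaDivergence

variable {S : Type*} [TopologicalSpace S]

/-- The cost is a supremum of differences `u x - u y` over a nonempty family of bounded
continuous functions. -/
def CostRepresentable (c : S → S → ℝ≥0∞) : Prop :=
  ∃ Q : Set (S →ᵇ ℝ), Q.Nonempty ∧
    ∀ x y, (c x y : EReal) = ⨆ u ∈ Q, ((u x - u y : ℝ) : EReal)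

/-- The class `Lip(c, S; C_b(S))`. -/
def costLip (c : S → S → ℝ≥0∞) : Set (S →ᵇ ℝ) :=
  {f | ∀ x y, ((f x - f y : ℝ) : EReal) ≤ (c x y : EReal)}

variable [MeasurableSpace S]

/-- A class of test functions that separates Borel probability measures. -/
def MeasureDetermining (Γ : Set (S →ᵇ ℝ)) : Prop :=
  ∀ μ ν : ProbabilityMeasure S, μ ≠ ν → ∃ f ∈ Γ, ∫ x, f x ∂(μ : Measure S) ≠ ∫ x, f x ∂(ν : Measure S)

/-- The `Γ`-divergence `G_Γ(μ‖ν) = sup_{g ∈ Γ} (∫ g dμ - log ∫ e^g dν)`. -/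
noncomputable def gammaDivergence (Γ : Set (S →ᵇ ℝ)) (μ ν : ProbabilityMeasure S) : EReal :=
  ⨆ g ∈ Γ, ((∫ x, g x ∂(μ : Measure S)
    - Real.log (∫ x, Real.exp (g x) ∂(ν : Measure S)) : ℝ) : EReal)

/-- `W_Γ(μ, γ) = sup_{g ∈ Γ} ∫ g d(μ - γ)`. -/
noncomputable def gammaTransport (Γ : Set (S →ᵇ ℝ)) (μ γ : ProbabilityMeasure S) : EReal :=
  ⨆ g ∈ Γ, ((∫ x, g x ∂(μ : Measure S) - ∫ x, g x ∂(γ : Measure S) : ℝ) : EReal)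

/-- Relative entropy `R(γ‖ν)`; for probability measures it is `∫ log (dγ/dν) dγ` if `γ ≪ ν`
(with value `∞` if this integral diverges) and `∞` otherwise. -/
noncomputable def relEntropy (γ ν : ProbabilityMeasure S) : ℝ≥0∞ :=
  InformationTheory.klDiv (γ : Measure S) (ν : Measure S)

/-- The constraint `W_Γ(μ, γ) = inf_{θ ≪ ν} W_Γ(μ, θ)`. -/
def AttainsTransportInf (Γ : Set (S →ᵇ ℝ)) (μ ν γ : ProbabilityMeasure S) : Prop :=
  gammaTransport Γ μ γ =
    ⨅ θ : ProbabilityMeasure S, ⨅ _ : (θ : Measure S) ≪ (ν : Measure S), gammaTransport Γ μ θ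

/-- `γ` minimizes `R(·‖ν)` over all probability measures that satisfy the constraint. -/
def IsConstrainedEntropyMinimizer (Γ : Set (S →ᵇ ℝ)) (μ ν γ : ProbabilityMeasure S) : Prop :=
  AttainsTransportInf Γ μ ν γ ∧
    ∀ γ' : ProbabilityMeasure S, AttainsTransportInf Γ μ ν γ' → relEntropy γ ν ≤ relEntropy γ' ν

end GammaDivergence

open Classical in
/-- The indices `j` such that `x i` is a point among the `x l` closest to `y j` with respect
to the cost `c`. -/
noncomputable def nearestIndices {S : Type*} (c : S → S → ℝ≥0∞) {N M : ℕ}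
    (x : Fin N → S) (y : Fin M → S) (i : Fin N) : Finset (Fin M) :=
  Finset.univ.filter fun j => ∀ l, c (y j) (x i) ≤ c (y j) (x l)

/-!
A symmetric, finite and representable cost whose potentials separate measures is a metric `d` on
`S`. Since `μ` and `ν` are finitely supported, every quantity only involves the values of the
potentials at finitely many points. A function that contracts `d` strictly can be interpolated on a
finite set by bounded continuous potentials, by the lattice argument of the Stone-Weierstrass
theorem (`exists_costLip_eqOn_finset`). Hence the suprema over `costLip c` are maxima over *all*
functions `f : S → ℝ` with `f p - f q ≤ d p q` (`iSup_costLip_eq`). These functions, normalized at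
one point, are compact for pointwise convergence. Measures absolutely continuous with respect to `ν`
become weights `w` in a simplex, with transport cost `T w` and entropy `H w`, both continuous.

The duality `G_b = min_w (b T w + H w)` needs no minimax theorem. Weak duality is Gibbs' inequality
(`divergenceObjective_le`). Conversely, if `f` maximizes `b ∫ f dμ - log ∫ exp (b f) dν`, then the
first order condition says that `f` is an optimal transport potential between `μ` and the measure
proportional to `exp (b f) dν`, and this measure attains equality
(`exists_divergenceObjective_eq`).

The limit measure `γ` minimizes `H` among the minimizers of `T`; it is unique because `T` is convex
and `H` strictly convex. Weak duality at `γ` gives `r b ≤ 0`. If `v b` is dual optimal for `b`, then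
`H (v b) - H γ ≤ r b`, and the left side has nonnegative limit inferior by compactness
(`IsCompact.eventually_lt_of_penalized`).

When the costs from each `y j` are distinct, moving every mass to its nearest atom is the only
minimizer of `T`. This is seen by testing `T` on the explicit potentials
`p ↦ min_l (d p (x l) + s l)` for small perturbations `s`
(`eq_pushWeights_of_weightTransport_le`), without constructing couplings.
-/

/-! ### Discrete integrals, relative entropy and exponential tilting -/

section DiscreteEntropy

open InformationTheory

variable {S ι : Type*} [Fintype ι]

/-- The integral of `f` against the signed measure `∑ i, w i • δ (x i)`. -/
def weightedSum (w : ι → ℝ) (x : ι → S) (f : S → ℝ) : ℝ := ∑ i, w i * f (x i)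

/-- Relative entropy of the weights `w` with respect to the weights `n`, written with
`klFun t = t * log t + 1 - t` so that continuity and convexity are inherited termwise. -/
noncomputable def weightEntropy (n w : ι → ℝ) : ℝ := ∑ i, n i * klFun (w i / n i)

/-- The probability weights proportional to `n i * exp (h (x i))`. -/
noncomputable def tiltedWeights (n : ι → ℝ) (x : ι → S) (h : S → ℝ) (i : ι) : ℝ :=
  n i * Real.exp (h (x i)) / weightedSum n x fun p => Real.exp (h p)

lemma weightedSum_congr {w : ι → ℝ} {x : ι → S} {f g : S → ℝ} (h : ∀ i, f (x i) = g (x i)) :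
    weightedSum w x f = weightedSum w x g :=
  Finset.sum_congr rfl fun i _ => by rw [h i]

lemma weightedSum_add (w : ι → ℝ) (x : ι → S) (f g : S → ℝ) :
    weightedSum w x (fun p => f p + g p) = weightedSum w x f + weightedSum w x g := by
  simp [weightedSum, mul_add, Finset.sum_add_distrib]

lemma weightedSum_sub (w : ι → ℝ) (x : ι → S) (f g : S → ℝ) :
    weightedSum w x (fun p => f p - g p) = weightedSum w x f - weightedSum w x g := by
  simp [weightedSum, mul_sub, Finset.sum_sub_distrib]

lemma weightedSum_mul_left (w : ι → ℝ) (x : ι → S) (b : ℝ) (f : S → ℝ) :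
    weightedSum w x (fun p => b * f p) = b * weightedSum w x f := by
  simp only [weightedSum, Finset.mul_sum]
  exact Finset.sum_congr rfl fun i _ => by ring

lemma weightedSum_const {w : ι → ℝ} (hw : ∑ i, w i = 1) (x : ι → S) (a : ℝ) :
    weightedSum w x (fun _ => a) = a := by
  simp [weightedSum, ← Finset.sum_mul, hw]

lemma continuous_weightEntropy (n : ι → ℝ) : Continuous (weightEntropy n) := by
  have := continuous_klFun
  unfold weightEntropy
  fun_prop

lemma weightEntropy_nonneg {n w : ι → ℝ} (hn : ∀ i, 0 < n i) (hw : ∀ i, 0 ≤ w i) :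
    0 ≤ weightEntropy n w :=
  Finset.sum_nonneg fun i _ => mul_nonneg (hn i).le (klFun_nonneg (div_nonneg (hw i) (hn i).le))

lemma weightEntropy_self {n : ι → ℝ} (hn : ∀ i, 0 < n i) : weightEntropy n n = 0 :=
  Finset.sum_eq_zero fun i _ => by rw [div_self (hn i).ne', klFun_one, mul_zero]

lemma weightEntropy_midpoint_lt {n w v : ι → ℝ} (hn : ∀ i, 0 < n i) (hw : ∀ i, 0 ≤ w i)
    (hv : ∀ i, 0 ≤ v i) (hwv : w ≠ v) :
    weightEntropy n (fun i => (w i + v i) / 2) < (weightEntropy n w + weightEntropy n v) / 2 := by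
  have key : ∀ i, (w i + v i) / 2 / n i = (1 / 2 : ℝ) • (w i / n i) + (1 / 2 : ℝ) • (v i / n i) := by
    intro i
    simp only [smul_eq_mul]
    ring
  have hrhs : (weightEntropy n w + weightEntropy n v) / 2 =
      ∑ i, n i * ((1 / 2 : ℝ) • klFun (w i / n i) + (1 / 2 : ℝ) • klFun (v i / n i)) := by
    simp only [weightEntropy, ← Finset.sum_add_distrib, Finset.sum_div, smul_eq_mul]
    exact Finset.sum_congr rfl fun i _ => by ring
  rw [hrhs]
  simp only [weightEntropy, key]
  obtain ⟨i, hi⟩ := Function.ne_iff.1 hwv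
  refine Finset.sum_lt_sum (fun j _ => ?_) ⟨i, Finset.mem_univ i, ?_⟩
  · exact mul_le_mul_of_nonneg_left (convexOn_klFun.2 (div_nonneg (hw j) (hn j).le)
      (div_nonneg (hv j) (hn j).le) (by norm_num) (by norm_num) (by norm_num)) (hn j).le
  · refine mul_lt_mul_of_pos_left (strictConvexOn_klFun.2 (div_nonneg (hw i) (hn i).le)
      (div_nonneg (hv i) (hn i).le) (fun h => hi ?_) (by norm_num) (by norm_num) (by norm_num))
      (hn i)
    exact (div_left_inj' (hn i).ne').1 h

lemma weightedSum_exp_pos [Nonempty ι] {n : ι → ℝ} (hn : ∀ i, 0 < n i) (x : ι → S) (h : S → ℝ) :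
    0 < weightedSum n x fun p => Real.exp (h p) :=
  Finset.sum_pos (fun i _ => mul_pos (hn i) (Real.exp_pos _)) Finset.univ_nonempty

lemma tiltedWeights_pos [Nonempty ι] {n : ι → ℝ} (hn : ∀ i, 0 < n i) (x : ι → S) (h : S → ℝ)
    (i : ι) : 0 < tiltedWeights n x h i :=
  div_pos (mul_pos (hn i) (Real.exp_pos _)) (weightedSum_exp_pos hn x h)

lemma tiltedWeights_mem [Nonempty ι] {n : ι → ℝ} (hn : ∀ i, 0 < n i) (x : ι → S) (h : S → ℝ) :
    tiltedWeights n x h ∈ stdSimplex ℝ ι := by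
  refine ⟨fun i => (tiltedWeights_pos hn x h i).le, ?_⟩
  simp only [tiltedWeights, ← Finset.sum_div]
  exact div_self (weightedSum_exp_pos hn x h).ne'

lemma weightEntropy_eq_sum_log {n w : ι → ℝ} (hn : ∀ i, 0 < n i)
    (h1 : ∑ i, n i = 1) (hw : ∑ i, w i = 1) :
    weightEntropy n w = ∑ i, w i * Real.log (w i / n i) := by
  have : ∀ i, n i * klFun (w i / n i) = w i * Real.log (w i / n i) + (n i - w i) := by
    intro i
    rw [klFun_apply]
    field_simp [(hn i).ne']
    ring
  simp only [weightEntropy, this, Finset.sum_add_distrib, Finset.sum_sub_distrib, h1, hw]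
  ring

/-- Changing the reference weights to the tilted ones subtracts a linear functional from the
entropy; this one identity contains both Gibbs' inequality and its equality case. -/
lemma weightEntropy_tiltedWeights [Nonempty ι] {n w : ι → ℝ} (hn : ∀ i, 0 < n i)
    (h1 : ∑ i, n i = 1) (hw : w ∈ stdSimplex ℝ ι) (x : ι → S) (h : S → ℝ) :
    weightEntropy (tiltedWeights n x h) w = weightEntropy n w - weightedSum w x h +
      Real.log (weightedSum n x fun p => Real.exp (h p)) := by
  have hZ := weightedSum_exp_pos hn x h
  rw [weightEntropy_eq_sum_log (tiltedWeights_pos hn x h) (tiltedWeights_mem hn x h).2 hw.2,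
    weightEntropy_eq_sum_log hn h1 hw.2]
  set Z := weightedSum n x fun p => Real.exp (h p) with hZdef
  have : ∀ i, w i * Real.log (w i / tiltedWeights n x h i) =
      w i * Real.log (w i / n i) - w i * h (x i) + w i * Real.log Z := by
    intro i
    rcases (hw.1 i).eq_or_lt with h0 | h0
    · simp [← h0]
    · rw [tiltedWeights, ← hZdef, Real.log_div h0.ne' (by have := hn i; positivity),
        Real.log_div (by have := hn i; positivity) hZ.ne',
        Real.log_mul (hn i).ne' (Real.exp_pos _).ne', Real.log_exp, Real.log_div h0.ne' (hn i).ne']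
      ring
  simp only [this, Finset.sum_add_distrib, Finset.sum_sub_distrib, ← Finset.sum_mul, hw.2, one_mul]
  rfl

lemma weightedSum_sub_log_le [Nonempty ι] {n w : ι → ℝ} (hn : ∀ i, 0 < n i)
    (h1 : ∑ i, n i = 1) (hw : w ∈ stdSimplex ℝ ι) (x : ι → S) (h : S → ℝ) :
    weightedSum w x h - Real.log (weightedSum n x fun p => Real.exp (h p)) ≤ weightEntropy n w := by
  have h2 := weightEntropy_tiltedWeights hn h1 hw x h
  have := weightEntropy_nonneg (tiltedWeights_pos hn x h) hw.1
  linarith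

lemma weightEntropy_tiltedWeights_eq [Nonempty ι] {n : ι → ℝ} (hn : ∀ i, 0 < n i)
    (h1 : ∑ i, n i = 1) (x : ι → S) (h : S → ℝ) :
    weightEntropy n (tiltedWeights n x h) = weightedSum (tiltedWeights n x h) x h -
      Real.log (weightedSum n x fun p => Real.exp (h p)) := by
  have h2 := weightEntropy_tiltedWeights hn h1 (tiltedWeights_mem hn x h) x h
  rw [weightEntropy_self (tiltedWeights_pos hn x h)] at h2
  linarith

end DiscreteEntropy

/-! ### The discrete transport problem over all Lipschitz potentials -/

section DiscreteTransport

variable {S ι κ : Type*} [Fintype ι] [Fintype κ]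

/-- All real functions, continuous or not, that are `1`-Lipschitz for `d`. -/
def lipPotentials (d : S → S → ℝ) : Set (S → ℝ) := {f | ∀ p q, f p - f q ≤ d p q}

/-- The dual transport objective `∫ f dμ - ∫ f dγ` for the discrete measures
`μ = ∑ j, m j • δ (y j)` and `γ = ∑ i, w i • δ (x i)`. -/
def potentialGap (m : κ → ℝ) (y : κ → S) (x : ι → S) (w : ι → ℝ) (f : S → ℝ) : ℝ :=
  weightedSum m y f - weightedSum w x f

/-- The dual transport cost. The supremum is restricted to potentials that vanish at `p₀`, which
form a compact set for pointwise convergence; this does not change its value. -/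
noncomputable def weightTransport (d : S → S → ℝ) (p₀ : S) (m : κ → ℝ) (y : κ → S) (x : ι → S)
    (w : ι → ℝ) : ℝ :=
  sSup (potentialGap m y x w '' (lipPotentials d ∩ {f | f p₀ = 0}))

lemma isCompact_lipPotentials_inter (d : S → S → ℝ) (p₀ : S) :
    IsCompact (lipPotentials d ∩ {f | f p₀ = 0}) := by
  refine (isCompact_univ_pi fun p => isCompact_Icc (a := -d p₀ p) (b := d p p₀)).of_isClosed_subset
    (IsClosed.inter ?_ (isClosed_eq (continuous_apply p₀) continuous_const)) ?_
  · simp only [lipPotentials, Set.ofPred_forall]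
    exact isClosed_iInter fun p => isClosed_iInter fun q =>
      isClosed_le ((continuous_apply p).sub (continuous_apply q)) continuous_const
  · rintro f ⟨hf, hf0⟩ p -
    have h1 := hf p p₀
    have h2 := hf p₀ p
    rw [Set.mem_ofPred_eq] at hf0
    rw [hf0] at h1 h2
    constructor <;> linarith

lemma zero_mem_lipPotentials {d : S → S → ℝ} (hd : ∀ p q, 0 ≤ d p q) :
    (0 : S → ℝ) ∈ lipPotentials d := fun p q => by simpa using hd p q

lemma sub_const_mem_lipPotentials {d : S → S → ℝ} {f : S → ℝ} (hf : f ∈ lipPotentials d) (p₀ : S) :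
    (fun p => f p - f p₀) ∈ lipPotentials d ∩ {f | f p₀ = 0} :=
  ⟨fun p q => by simpa using hf p q, by simp⟩

lemma continuous_potentialGap (m : κ → ℝ) (y : κ → S) (x : ι → S) :
    Continuous fun a : (ι → ℝ) × (S → ℝ) => potentialGap m y x a.1 a.2 := by
  unfold potentialGap weightedSum
  fun_prop

lemma potentialGap_sub_const {m : κ → ℝ} (hm : ∑ j, m j = 1) {w : ι → ℝ} (hw : ∑ i, w i = 1)
    (y : κ → S) (x : ι → S) (f : S → ℝ) (a : ℝ) :
    potentialGap m y x w (fun p => f p - a) = potentialGap m y x w f := by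
  simp only [potentialGap, weightedSum_sub, weightedSum_const hm, weightedSum_const hw]
  ring

lemma continuous_weightTransport (d : S → S → ℝ) (p₀ : S) (m : κ → ℝ) (y : κ → S) (x : ι → S) :
    Continuous (weightTransport d p₀ m y x) :=
  (isCompact_lipPotentials_inter d p₀).continuous_sSup (continuous_potentialGap m y x)

lemma isGreatest_weightTransport {d : S → S → ℝ} (hd : ∀ p q, 0 ≤ d p q) (p₀ : S)
    {m : κ → ℝ} (hm : ∑ j, m j = 1) {w : ι → ℝ} (hw : ∑ i, w i = 1) (y : κ → S) (x : ι → S) :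
    IsGreatest (potentialGap m y x w '' lipPotentials d) (weightTransport d p₀ m y x w) := by
  have hcont : Continuous (potentialGap m y x w) :=
    (continuous_potentialGap m y x).comp (Continuous.prodMk_right w)
  have hcpt := (isCompact_lipPotentials_inter d p₀).image hcont
  constructor
  · obtain ⟨f, hf, hf'⟩ := hcpt.sSup_mem ⟨_, 0, ⟨zero_mem_lipPotentials hd, rfl⟩, rfl⟩
    exact ⟨f, hf.1, hf'⟩
  · rintro _ ⟨f, hf, rfl⟩
    rw [← potentialGap_sub_const hm hw y x f (f p₀)]
    exact le_csSup hcpt.bddAbove ⟨_, sub_const_mem_lipPotentials hf p₀, rfl⟩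

lemma weightTransport_midpoint_le {d : S → S → ℝ} (hd : ∀ p q, 0 ≤ d p q) (p₀ : S)
    {m : κ → ℝ} (hm : ∑ j, m j = 1) {w v : ι → ℝ} (hw : ∑ i, w i = 1) (hv : ∑ i, v i = 1)
    (y : κ → S) (x : ι → S) :
    weightTransport d p₀ m y x (fun i => (w i + v i) / 2) ≤
      (weightTransport d p₀ m y x w + weightTransport d p₀ m y x v) / 2 := by
  have hwv : ∑ i, (w i + v i) / 2 = 1 := by
    rw [← Finset.sum_div, Finset.sum_add_distrib, hw, hv]
    norm_num
  obtain ⟨f, hf, hfe⟩ := (isGreatest_weightTransport hd p₀ hm hwv y x).1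
  have h1 := (isGreatest_weightTransport hd p₀ hm hw y x).2 ⟨f, hf, rfl⟩
  have h2 := (isGreatest_weightTransport hd p₀ hm hv y x).2 ⟨f, hf, rfl⟩
  have h3 : potentialGap m y x (fun i => (w i + v i) / 2) f =
      (potentialGap m y x w f + potentialGap m y x v f) / 2 := by
    have : weightedSum (fun i => (w i + v i) / 2) x f =
        (weightedSum w x f + weightedSum v x f) / 2 := by
      simp only [weightedSum, ← Finset.sum_add_distrib, Finset.sum_div]
      exact Finset.sum_congr rfl fun i _ => by ring
    simp only [potentialGap, this]
    ring
  rw [← hfe, h3]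
  linarith

end DiscreteTransport

/-! ### Duality for the discrete divergence -/

section DiscreteDuality

variable {S ι κ : Type*} [Fintype ι] [Fintype κ]

/-- The divergence objective `b ∫ f dμ - log ∫ exp (b f) dν` for discrete `μ` and `ν`. -/
noncomputable def divergenceObjective (m : κ → ℝ) (y : κ → S) (n : ι → ℝ) (x : ι → S) (b : ℝ)
    (f : S → ℝ) : ℝ :=
  b * weightedSum m y f - Real.log (weightedSum n x fun p => Real.exp (b * f p))

lemma continuous_divergenceObjective [Nonempty ι] (m : κ → ℝ) (y : κ → S) {n : ι → ℝ}
    (hn : ∀ i, 0 < n i) (x : ι → S) (b : ℝ) : Continuous (divergenceObjective m y n x b) := by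
  have h1 : Continuous fun f : S → ℝ => weightedSum n x fun p => Real.exp (b * f p) := by
    unfold weightedSum
    fun_prop
  have h2 : Continuous (weightedSum m y) := by
    unfold weightedSum
    fun_prop
  exact (continuous_const.mul h2).sub
    (h1.log fun f => (weightedSum_exp_pos hn x fun p => b * f p).ne')

lemma divergenceObjective_sub_const [Nonempty ι] {m : κ → ℝ} (hm : ∑ j, m j = 1) (y : κ → S)
    {n : ι → ℝ} (hn : ∀ i, 0 < n i) (x : ι → S) (b : ℝ) (f : S → ℝ) (a : ℝ) :
    divergenceObjective m y n x b (fun p => f p - a) = divergenceObjective m y n x b f := by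
  have h : (fun p => Real.exp (b * (f p - a))) = fun p => Real.exp (-(b * a)) * Real.exp (b * f p) := by
    funext p
    rw [← Real.exp_add]
    ring_nf
  simp only [divergenceObjective, h, weightedSum_mul_left, weightedSum_sub, weightedSum_const hm]
  rw [Real.log_mul (Real.exp_pos _).ne' (weightedSum_exp_pos hn x fun p => b * f p).ne',
    Real.log_exp]
  ring

/-- Weak duality, from Gibbs' inequality. -/
lemma divergenceObjective_le [Nonempty ι] {m : κ → ℝ} (y : κ → S)
    {n w : ι → ℝ} (hn : ∀ i, 0 < n i) (h1 : ∑ i, n i = 1) (hw : w ∈ stdSimplex ℝ ι) (x : ι → S)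
    (b : ℝ) (f : S → ℝ) :
    divergenceObjective m y n x b f ≤ b * potentialGap m y x w f + weightEntropy n w := by
  have := weightedSum_sub_log_le hn h1 hw x fun p => b * f p
  rw [weightedSum_mul_left] at this
  simp only [divergenceObjective, potentialGap]
  linarith

lemma divergenceObjective_eq_tiltedWeights [Nonempty ι] {m : κ → ℝ} (y : κ → S)
    {n : ι → ℝ} (hn : ∀ i, 0 < n i) (h1 : ∑ i, n i = 1) (x : ι → S) (b : ℝ) (f : S → ℝ) :
    divergenceObjective m y n x b f =
      b * potentialGap m y x (tiltedWeights n x fun p => b * f p) f +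
        weightEntropy n (tiltedWeights n x fun p => b * f p) := by
  rw [weightEntropy_tiltedWeights_eq hn h1, weightedSum_mul_left]
  simp only [divergenceObjective, potentialGap]
  ring

/-- Strong duality. A maximizing potential `f` exists by compactness, and its first order
optimality condition says that `f` is also an optimal transport potential between `μ` and the
measure proportional to `exp (b f) dν`. -/
lemma exists_divergenceObjective_eq [Nonempty ι] {d : S → S → ℝ} (hd : ∀ p q, 0 ≤ d p q) (p₀ : S)
    {m : κ → ℝ} (hm : ∑ j, m j = 1) (y : κ → S) {n : ι → ℝ} (hn : ∀ i, 0 < n i)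
    (h1 : ∑ i, n i = 1) (x : ι → S) {b : ℝ} (hb : 0 < b) :
    ∃ f ∈ lipPotentials d,
      (∀ g ∈ lipPotentials d, divergenceObjective m y n x b g ≤ divergenceObjective m y n x b f) ∧
      ∃ w ∈ stdSimplex ℝ ι, divergenceObjective m y n x b f =
        b * weightTransport d p₀ m y x w + weightEntropy n w := by
  obtain ⟨f, hf, hmax⟩ := (isCompact_lipPotentials_inter d p₀).exists_isMaxOn
    ⟨0, zero_mem_lipPotentials hd, rfl⟩ (continuous_divergenceObjective m y hn x b).continuousOn
  have hmax' : ∀ g ∈ lipPotentials d,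
      divergenceObjective m y n x b g ≤ divergenceObjective m y n x b f := fun g hg => by
    rw [← divergenceObjective_sub_const hm y hn x b g (g p₀)]
    exact hmax (sub_const_mem_lipPotentials hg p₀)
  set w := tiltedWeights n x fun p => b * f p with hw
  have hwmem : w ∈ stdSimplex ℝ ι := tiltedWeights_mem hn x _
  refine ⟨f, hf.1, hmax', w, hwmem, ?_⟩
  have hgr := isGreatest_weightTransport hd p₀ hm hwmem.2 y x
  -- Compare `f` with `f + t (g - f)` and let `t → 0+`; the weights `v t` tilted by the latter
  -- turn the maximality of `f` into a linear inequality in `g - f`.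
  have hle : ∀ g ∈ lipPotentials d, potentialGap m y x w g ≤ potentialGap m y x w f := by
    intro g hg
    let ft : ℝ → S → ℝ := fun t p => f p + t * (g p - f p)
    let v : ℝ → ι → ℝ := fun t => tiltedWeights n x fun p => b * ft t p
    have hv0 : v 0 = w := by simp [v, ft, hw]
    have hvc : Continuous v := by
      refine continuous_pi fun i => ?_
      refine Continuous.div ?_ ?_ fun t => (weightedSum_exp_pos hn x fun p => b * ft t p).ne'
      · simp only [ft]
        fun_prop
      · simp only [ft, weightedSum]
        fun_prop
    have hgap : ∀ t u, potentialGap m y x u (ft t) = potentialGap m y x u f +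
        t * (potentialGap m y x u g - potentialGap m y x u f) := by
      intro t u
      simp only [potentialGap, ft, weightedSum_add, weightedSum_mul_left, weightedSum_sub]
      ring
    have hstep : ∀ t ∈ Set.Ioo (0 : ℝ) 1,
        potentialGap m y x (v t) g - potentialGap m y x (v t) f ≤ 0 := by
      rintro t ⟨ht0, ht1⟩
      have hft : ft t ∈ lipPotentials d := fun p q => by
        have h2 := mul_le_mul_of_nonneg_left (hf.1 p q) (sub_nonneg.2 ht1.le)
        have h3 := mul_le_mul_of_nonneg_left (hg p q) ht0.le
        simp only [ft]
        linarith
      have h4 := hmax' _ hft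
      rw [divergenceObjective_eq_tiltedWeights y hn h1] at h4
      have h5 := divergenceObjective_le (m := m) y hn h1
        (tiltedWeights_mem hn x fun p => b * ft t p) x b f
      change b * potentialGap m y x (v t) (ft t) + weightEntropy n (v t) ≤ _ at h4
      change _ ≤ b * potentialGap m y x (v t) f + weightEntropy n (v t) at h5
      rw [hgap] at h4
      have h6 : b * t * (potentialGap m y x (v t) g - potentialGap m y x (v t) f) ≤ 0 := by linarith
      exact nonpos_of_mul_nonpos_right h6 (mul_pos hb ht0)
    have hc : ∀ u : S → ℝ, Continuous fun t => potentialGap m y x (v t) u := fun u =>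
      (continuous_potentialGap m y x).comp (hvc.prodMk continuous_const)
    have hlim : Tendsto (fun t => potentialGap m y x (v t) g - potentialGap m y x (v t) f)
        (𝓝[>] 0) (𝓝 (potentialGap m y x w g - potentialGap m y x w f)) := by
      rw [← hv0]
      exact (((hc g).sub (hc f)).tendsto 0).mono_left nhdsWithin_le_nhds
    have := le_of_tendsto hlim
      (Filter.eventually_of_mem (Ioo_mem_nhdsGT one_pos) hstep)
    linarith
  have hT : weightTransport d p₀ m y x w = potentialGap m y x w f := by
    refine le_antisymm ?_ (hgr.2 ⟨f, hf.1, rfl⟩)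
    obtain ⟨g, hg, hge⟩ := hgr.1
    exact hge ▸ hle g hg
  rw [hT]
  exact divergenceObjective_eq_tiltedWeights y hn h1 x b f

end DiscreteDuality

/-! ### Lexicographic minimization and vanishing entropic penalties -/

section Lexicographic

variable {X : Type*} [TopologicalSpace X]

lemma IsCompact.exists_lexicographic_min {K : Set X} (hK : IsCompact K) (hne : K.Nonempty)
    {T H : X → ℝ} (hT : Continuous T) (hH : Continuous H) :
    ∃ w ∈ K, (∀ v ∈ K, T w ≤ T v) ∧ ∀ v ∈ K, T v ≤ T w → H w ≤ H v := by
  obtain ⟨u, hu, humin⟩ := hK.exists_isMinOn hne hT.continuousOn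
  obtain ⟨w, hw, hwmin⟩ := (hK.inter_right (isClosed_le hT (continuous_const (y := T u)))).exists_isMinOn
    ⟨u, hu, le_refl (T u)⟩ hH.continuousOn
  refine ⟨w, hw.1, fun v hv => le_trans hw.2 (humin hv), fun v hv hvT => hwmin ⟨hv, ?_⟩⟩
  exact le_trans hvT hw.2

/-- If `v b` nearly minimizes `b * T + H` for all `b`, then its `T`-value is forced down to the
minimum as `b → ∞`, so that the `H`-value of the lexicographic minimizer `w` is approached. -/
lemma IsCompact.eventually_lt_of_penalized {K : Set X} (hK : IsCompact K)
    {T H : X → ℝ} (hT : Continuous T) (hH : Continuous H) (hH0 : ∀ v ∈ K, 0 ≤ H v) {w : X}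
    (hwH : ∀ v ∈ K, T v ≤ T w → H w ≤ H v) {v : ℝ → X}
    (hv : ∀ b, 0 < b → v b ∈ K) (hvb : ∀ b, 0 < b → b * T (v b) + H (v b) ≤ b * T w + H w)
    {ε : ℝ} (hε : 0 < ε) : ∀ᶠ b in atTop, H w - ε < H (v b) := by
  have hC : IsCompact (K ∩ {u | H u ≤ H w - ε}) :=
    hK.inter_right (isClosed_le hH continuous_const)
  rcases (K ∩ {u | H u ≤ H w - ε}).eq_empty_or_nonempty with he | hne
  · filter_upwards [eventually_gt_atTop 0] with b hb
    by_contra! hcon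
    exact (Set.eq_empty_iff_forall_notMem.1 he (v b)) ⟨hv b hb, hcon⟩
  · obtain ⟨u, hu, humin⟩ := hC.exists_isMinOn hne hT.continuousOn
    have hlt : T w < T u := by
      by_contra! hcon
      have h1 := hwH u hu.1 hcon
      have h2 : H u ≤ H w - ε := hu.2
      linarith
    filter_upwards [eventually_gt_atTop 0, eventually_gt_atTop (H w / (T u - T w))] with b hb hb'
    by_contra! hcon
    have h1 : T u ≤ T (v b) := humin ⟨hv b hb, hcon⟩
    have h2 := hvb b hb
    have h3 := hH0 _ (hv b hb)
    rw [div_lt_iff₀ (sub_pos.2 hlt)] at hb'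
    have h4 := mul_le_mul_of_nonneg_left h1 hb.le
    linarith

end Lexicographic

/-! ### Transport to the nearest atoms -/

section Nearest

variable {S ι κ : Type*} [Fintype ι] [Fintype κ]

open Classical in
/-- The weights obtained by moving the mass `m j` to the index `σ j`. -/
noncomputable def pushWeights (m : κ → ℝ) (σ : κ → ι) (i : ι) : ℝ :=
  ∑ j with σ j = i, m j

lemma weightedSum_pushWeights (m : κ → ℝ) (σ : κ → ι) (x : ι → S) (f : S → ℝ) :
    weightedSum (pushWeights m σ) x f = weightedSum m (x ∘ σ) f := by
  classical
  simp only [weightedSum, pushWeights, Finset.sum_mul, Function.comp_apply]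
  rw [← Finset.sum_fiberwise Finset.univ σ fun j => m j * f (x (σ j))]
  refine Finset.sum_congr rfl fun i _ => ?_
  rw [Finset.sum_congr (by congr) fun j hj => ?_]
  rw [(Finset.mem_filter.1 hj).2]

lemma sum_pushWeights (m : κ → ℝ) (σ : κ → ι) : ∑ i, pushWeights m σ i = ∑ j, m j := by
  simpa [weightedSum] using weightedSum_pushWeights m σ id fun _ => (1 : ℝ)

lemma pushWeights_mem {m : κ → ℝ} (hm : m ∈ stdSimplex ℝ κ) (σ : κ → ι) :
    pushWeights m σ ∈ stdSimplex ℝ ι :=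
  ⟨fun _ => Finset.sum_nonneg fun j _ => hm.1 j, (sum_pushWeights m σ).trans hm.2⟩

/-- If every `y j` has a unique nearest atom `x (σ j)`, then moving each mass to its nearest atom is
the only way to minimize the transport cost. The lower bound is tested on the potentials
`p ↦ min_l (d p (x l) + s l)`; with `s = 0` they give the optimal value, and raising one `s i`
slightly shows that the atom `x i` carries at least the mass sent to it. -/
lemma eq_pushWeights_of_weightTransport_le [Nonempty ι] {d : S → S → ℝ} (hd : ∀ p q, 0 ≤ d p q)
    (hself : ∀ p, d p p = 0) (htri : ∀ p q r, d p r ≤ d p q + d q r) (p₀ : S)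
    {m : κ → ℝ} (hm : m ∈ stdSimplex ℝ κ) (y : κ → S) (x : ι → S)
    (hx : ∀ i l, i ≠ l → 0 < d (x i) (x l)) {σ : κ → ι}
    (hσ : ∀ j l, l ≠ σ j → d (y j) (x (σ j)) < d (y j) (x l)) {w : ι → ℝ}
    (hw : ∑ i, w i = 1)
    (hmin : weightTransport d p₀ m y x w ≤ weightTransport d p₀ m y x (pushWeights m σ)) :
    w = pushWeights m σ := by
  classical
  set D : ℝ := ∑ j, m j * d (y j) (x (σ j)) with hD
  have hpush := pushWeights_mem hm σ
  have hupper : weightTransport d p₀ m y x (pushWeights m σ) ≤ D := by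
    obtain ⟨f, hf, hfe⟩ := (isGreatest_weightTransport hd p₀ hm.2 hpush.2 y x).1
    rw [← hfe, potentialGap, weightedSum_pushWeights]
    simp only [weightedSum, ← Finset.sum_sub_distrib, ← mul_sub, Function.comp_apply]
    exact Finset.sum_le_sum fun j _ => mul_le_mul_of_nonneg_left (hf _ _) (hm.1 j)
  -- A common lower bound for the finitely many gaps in the hypotheses.
  obtain ⟨ε, hε, hεx, hεy⟩ : ∃ ε > 0, (∀ i l, i ≠ l → ε ≤ d (x i) (x l)) ∧
      ∀ j l, l ≠ σ j → d (y j) (x (σ j)) + ε ≤ d (y j) (x l) := by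
    have h1 : ∀ᶠ ε in 𝓝[>] (0 : ℝ), ∀ i l, i ≠ l → ε ≤ d (x i) (x l) := by
      refine eventually_all.2 fun i => eventually_all.2 fun l => ?_
      by_cases h : i = l
      · simp [h]
      · filter_upwards [Ioc_mem_nhdsGT (hx i l h)] with e he _ using he.2
    have h2 : ∀ᶠ ε in 𝓝[>] (0 : ℝ), ∀ j l, l ≠ σ j → d (y j) (x (σ j)) + ε ≤ d (y j) (x l) := by
      refine eventually_all.2 fun j => eventually_all.2 fun l => ?_
      by_cases h : l = σ j
      · simp [h]
      · filter_upwards [Ioc_mem_nhdsGT (sub_pos.2 (hσ j l h))] with e he _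
        linarith [he.2]
    obtain ⟨ε, ⟨h3, h4⟩, h5⟩ := ((h1.and h2).and self_mem_nhdsWithin).exists
    exact ⟨ε, h5, h3, h4⟩
  have hle : ∀ i, pushWeights m σ i ≤ w i := by
    intro i
    let s : ι → ℝ := fun l => if l = i then ε else 0
    have hs0 : ∀ l, 0 ≤ s l := fun l => by simp only [s]; split_ifs <;> linarith
    have hs1 : ∀ l, s l ≤ ε := fun l => by simp only [s]; split_ifs <;> linarith
    let f : S → ℝ := fun p => Finset.univ.inf' Finset.univ_nonempty fun l => d p (x l) + s l
    have hfle : ∀ p l, f p ≤ d p (x l) + s l := fun p l =>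
      Finset.inf'_le (fun l => d p (x l) + s l) (Finset.mem_univ l)
    have hf : f ∈ lipPotentials d := by
      intro p q
      obtain ⟨l, -, hl⟩ := Finset.exists_mem_eq_inf' Finset.univ_nonempty
        fun l => d q (x l) + s l
      have h1 : f q = d q (x l) + s l := hl
      linarith [hfle p l, htri p q (x l)]
    have hfx : ∀ l, f (x l) = s l := by
      intro l
      refine le_antisymm ((hfle _ l).trans_eq (by rw [hself, zero_add])) ?_
      refine Finset.le_inf' _ _ fun k _ => ?_
      by_cases hkl : l = k
      · subst hkl
        linarith [hd (x l) (x l)]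
      · linarith [hεx l k hkl, hs0 k, hs1 l]
    have hfy : ∀ j, f (y j) = d (y j) (x (σ j)) + s (σ j) := by
      intro j
      refine le_antisymm (hfle _ _) (Finset.le_inf' _ _ fun k _ => ?_)
      by_cases hk : k = σ j
      · rw [hk]
      · linarith [hεy j k hk, hs0 k, hs1 (σ j)]
    have h1 := (isGreatest_weightTransport hd p₀ hm.2 hw y x).2 ⟨f, hf, rfl⟩
    have h2 : weightedSum m y f = D + ε * pushWeights m σ i := by
      simp only [weightedSum, hfy, mul_add, Finset.sum_add_distrib, hD, add_right_inj]
      simp only [s, pushWeights, mul_ite, mul_zero, Finset.mul_sum]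
      rw [← Finset.sum_filter]
      exact Finset.sum_congr (by congr) fun j _ => mul_comm _ _
    have h3 : weightedSum w x f = ε * w i := by
      simp only [weightedSum, hfx, s, mul_ite, mul_zero, Finset.sum_ite_eq', Finset.mem_univ, if_true]
      exact mul_comm _ _
    rw [potentialGap, h2, h3] at h1
    exact le_of_mul_le_mul_left (by linarith) hε
  have hsum : ∑ i, pushWeights m σ i = ∑ i, w i := by rw [hpush.2, hw]
  funext i
  exact ((Finset.sum_eq_sum_iff_of_le fun i _ => hle i).1 hsum i (Finset.mem_univ i)).symm

end Nearest

/-! ### The cost as a metric, and interpolation by continuous potentials -/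

section Cost

variable {S : Type*} {c : S → S → ℝ≥0∞}

/-- The real value of a cost that takes only finite values. -/
noncomputable def realCost (c : S → S → ℝ≥0∞) (p q : S) : ℝ := (c p q).toReal

lemma realCost_nonneg (p q : S) : 0 ≤ realCost c p q := ENNReal.toReal_nonneg

lemma coe_realCost (hc : ∀ p q, c p q ≠ ∞) (p q : S) :
    ((realCost c p q : ℝ) : EReal) = (c p q : EReal) :=
  EReal.coe_ennreal_toReal (hc p q)

lemma realCost_comm (hsymm : ∀ p q, c p q = c q p) (p q : S) : realCost c p q = realCost c q p := by
  rw [realCost, hsymm, realCost]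

variable [TopologicalSpace S]

lemma mem_costLip_iff (hc : ∀ p q, c p q ≠ ∞) {f : S →ᵇ ℝ} :
    f ∈ costLip c ↔ (f : S → ℝ) ∈ lipPotentials (realCost c) :=
  forall_congr' fun p => forall_congr' fun q => by
    rw [← coe_realCost hc, EReal.coe_le_coe_iff]

lemma exists_costLip_lt (hc : ∀ p q, c p q ≠ ∞) (hr : CostRepresentable c) {p q : S} {t : ℝ}
    (ht : t < realCost c p q) : ∃ u ∈ costLip c, t < u p - u q := by
  obtain ⟨Q, -, hQ⟩ := hr
  have h1 : (t : EReal) < ⨆ u ∈ Q, ((u p - u q : ℝ) : EReal) := by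
    rw [← hQ, ← coe_realCost hc]
    exact_mod_cast ht
  simp only [lt_iSup_iff] at h1
  obtain ⟨u, hu, hlt⟩ := h1
  refine ⟨u, fun a b => ?_, by exact_mod_cast hlt⟩
  rw [hQ]
  exact le_iSup₂ (f := fun (u : S →ᵇ ℝ) (_ : u ∈ Q) => ((u a - u b : ℝ) : EReal)) u hu

lemma realCost_self (hc : ∀ p q, c p q ≠ ∞) (hr : CostRepresentable c) (p : S) :
    realCost c p p = 0 := by
  refine le_antisymm (le_of_forall_lt fun t ht => ?_) (realCost_nonneg p p)
  obtain ⟨u, -, hlt⟩ := exists_costLip_lt hc hr ht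
  simpa using hlt

lemma realCost_triangle (hc : ∀ p q, c p q ≠ ∞) (hr : CostRepresentable c) (p q r : S) :
    realCost c p r ≤ realCost c p q + realCost c q r := by
  refine le_of_forall_lt fun t ht => ?_
  obtain ⟨u, hu, hlt⟩ := exists_costLip_lt hc hr ht
  rw [mem_costLip_iff hc] at hu
  linarith [hu p q, hu q r]

lemma realCost_pos [T1Space S] [MeasurableSpace S] [BorelSpace S] (hsymm : ∀ p q, c p q = c q p)
    (hc : ∀ p q, c p q ≠ ∞) (hdet : MeasureDetermining (costLip c)) {p q : S} (hpq : p ≠ q) :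
    0 < realCost c p q := by
  obtain ⟨f, hf, hne⟩ := hdet ⟨Measure.dirac p, inferInstance⟩ ⟨Measure.dirac q, inferInstance⟩ (by
    intro h
    have h1 : Measure.dirac p = Measure.dirac q := congrArg Subtype.val h
    have h2 := congrArg (fun m : Measure S => m {p}) h1
    simp [hpq.symm] at h2)
  simp only [ProbabilityMeasure.coe_mk, integral_dirac] at hne
  rw [mem_costLip_iff hc] at hf
  rcases lt_or_gt_of_ne hne with h | h
  · rw [realCost_comm hsymm]
    linarith [hf q p]
  · linarith [hf p q]

lemma sup_mem_costLip (hc : ∀ p q, c p q ≠ ∞) {f g : S →ᵇ ℝ} (hf : f ∈ costLip c)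
    (hg : g ∈ costLip c) : f ⊔ g ∈ costLip c := by
  rw [mem_costLip_iff hc] at *
  intro p q
  have h1 := hf p q
  have h2 := hg p q
  have h3 : f q ≤ f q ⊔ g q := le_sup_left
  have h4 : g q ≤ f q ⊔ g q := le_sup_right
  simp only [BoundedContinuousFunction.coe_sup, Pi.sup_apply]
  rw [sub_le_iff_le_add]
  exact sup_le (by linarith) (by linarith)

lemma inf_mem_costLip (hc : ∀ p q, c p q ≠ ∞) {f g : S →ᵇ ℝ} (hf : f ∈ costLip c)
    (hg : g ∈ costLip c) : f ⊓ g ∈ costLip c := by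
  rw [mem_costLip_iff hc] at *
  intro p q
  have h1 := hf p q
  have h2 := hg p q
  have h3 : f p ⊓ g p ≤ f p := inf_le_left
  have h4 : f p ⊓ g p ≤ g p := inf_le_right
  simp only [BoundedContinuousFunction.coe_inf, Pi.inf_apply]
  rw [sub_le_comm]
  exact le_inf (by linarith) (by linarith)

lemma const_mem_costLip (hc : ∀ p q, c p q ≠ ∞) (a : ℝ) :
    BoundedContinuousFunction.const S a ∈ costLip c := by
  rw [mem_costLip_iff hc]
  intro p q
  simpa using realCost_nonneg (c := c) p q

/-- Values at two points whose difference is smaller than the cost are interpolated by a multiple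
of a potential that nearly realizes the cost, plus a constant. -/
lemma exists_costLip_pair (hsymm : ∀ p q, c p q = c q p) (hc : ∀ p q, c p q ≠ ∞)
    (hr : CostRepresentable c) {p q : S} {α β : ℝ} (h : |α - β| < realCost c p q) :
    ∃ g ∈ costLip c, g p = α ∧ g q = β := by
  obtain ⟨u, hu, hlt⟩ := exists_costLip_lt hc hr h
  have hu0 : 0 < u p - u q := (abs_nonneg _).trans_lt hlt
  set s : ℝ := (α - β) / (u p - u q) with hs
  have hs1 : |s| ≤ 1 := by
    rw [hs, abs_div, abs_of_pos hu0, div_le_one hu0]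
    exact hlt.le
  have hse : s * (u p - u q) = α - β := div_mul_cancel₀ _ hu0.ne'
  refine ⟨s • u + BoundedContinuousFunction.const S (β - s * u q), ?_, ?_, ?_⟩
  · rw [mem_costLip_iff hc] at *
    intro a b
    have h1 : |u a - u b| ≤ realCost c a b :=
      abs_le.2 ⟨by linarith [hu b a, realCost_comm hsymm a b], hu a b⟩
    have h2 : s * (u a - u b) ≤ realCost c a b := by
      calc s * (u a - u b) ≤ |s * (u a - u b)| := le_abs_self _
        _ = |s| * |u a - u b| := abs_mul _ _
        _ ≤ 1 * |u a - u b| := mul_le_mul_of_nonneg_right hs1 (abs_nonneg _)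
        _ ≤ realCost c a b := by rwa [one_mul]
    simp only [BoundedContinuousFunction.coe_add, BoundedContinuousFunction.coe_smul, Pi.add_apply,
      smul_eq_mul, BoundedContinuousFunction.const_apply]
    linarith
  · simp only [BoundedContinuousFunction.coe_add, BoundedContinuousFunction.coe_smul, Pi.add_apply,
      smul_eq_mul, BoundedContinuousFunction.const_apply]
    linarith
  · simp

/-- A strict contraction for the cost is interpolated on finite sets by bounded continuous
potentials: as in the Stone-Weierstrass theorem for lattices, two-point interpolants suffice. -/
lemma exists_costLip_eqOn_finset (hsymm : ∀ p q, c p q = c q p) (hc : ∀ p q, c p q ≠ ∞)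
    (hr : CostRepresentable c) {f : S → ℝ}
    (hf : ∀ p q, p ≠ q → |f p - f q| < realCost c p q) (F : Finset S) :
    ∃ g ∈ costLip c, ∀ p ∈ F, g p = f p := by
  classical
  have hpair : ∀ p q, ∃ g ∈ costLip c, g p = f p ∧ g q = f q := by
    intro p q
    by_cases hpq : p = q
    · subst hpq
      exact ⟨_, const_mem_costLip hc (f p), by simp⟩
    · exact exists_costLip_pair hsymm hc hr (hf p q hpq)
  have hinf : ∀ p, ∀ G : Finset S, ∃ g ∈ costLip c, g p = f p ∧ ∀ q ∈ G, g q ≤ f q := by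
    intro p G
    induction G using Finset.induction_on with
    | empty => exact ⟨_, const_mem_costLip hc (f p), by simp⟩
    | insert q G _ ih =>
      obtain ⟨g, hg, hgp, hgG⟩ := ih
      obtain ⟨k, hk, hkp, hkq⟩ := hpair p q
      refine ⟨g ⊓ k, inf_mem_costLip hc hg hk, by simp [hgp, hkp], fun r hr => ?_⟩
      rcases Finset.mem_insert.1 hr with rfl | hr
      · exact inf_le_right.trans_eq hkq
      · exact inf_le_left.trans (hgG r hr)
  have hsup : ∀ G ⊆ F, ∃ g ∈ costLip c, (∀ p ∈ G, f p ≤ g p) ∧ ∀ q ∈ F, g q ≤ f q := by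
    intro G
    induction G using Finset.induction_on with
    | empty =>
      intro _
      refine ⟨_, const_mem_costLip hc (-∑ p ∈ F, |f p|), by simp, fun q hq => ?_⟩
      have := Finset.single_le_sum (f := fun p => |f p|) (fun p _ => abs_nonneg _) hq
      simp only [BoundedContinuousFunction.const_apply]
      linarith [neg_abs_le (f q)]
    | insert p G _ ih =>
      intro hG
      obtain ⟨g, hg, hgG, hgF⟩ := ih fun r hr => hG (Finset.mem_insert_of_mem hr)
      obtain ⟨k, hk, hkp, hkF⟩ := hinf p F
      refine ⟨g ⊔ k, sup_mem_costLip hc hg hk, fun r hr => ?_, fun q hq => ?_⟩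
      · rcases Finset.mem_insert.1 hr with rfl | hr
        · exact hkp.ge.trans le_sup_right
        · exact (hgG r hr).trans le_sup_left
      · exact sup_le (hgF q hq) (hkF q hq)
  obtain ⟨g, hg, h1, h2⟩ := hsup F subset_rfl
  exact ⟨g, hg, fun p hp => le_antisymm (h2 p hp) (h1 p hp)⟩

/-- For an objective that only sees finitely many points, the supremum over bounded continuous
potentials equals the maximum over all Lipschitz potentials `f`: the contractions `t • f` with
`t < 1` can be interpolated. -/
lemma iSup_costLip_eq (hsymm : ∀ p q, c p q = c q p) (hc : ∀ p q, c p q ≠ ∞)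
    (hr : CostRepresentable c) (hpos : ∀ p q, p ≠ q → 0 < realCost c p q)
    {Ψ : (S → ℝ) → ℝ} (hΨ : Continuous Ψ) (F : Finset S)
    (hF : ∀ f g : S → ℝ, (∀ p ∈ F, f p = g p) → Ψ f = Ψ g) {f : S → ℝ}
    (hf : f ∈ lipPotentials (realCost c)) (hmax : ∀ g ∈ lipPotentials (realCost c), Ψ g ≤ Ψ f) :
    ⨆ g ∈ costLip c, (Ψ g : EReal) = (Ψ f : EReal) := by
  refine le_antisymm (iSup₂_le fun g hg => ?_) ?_
  · exact_mod_cast hmax g ((mem_costLip_iff hc).1 hg)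
  · have hlim : Tendsto (fun t : ℝ => (Ψ (fun p => t * f p) : EReal)) (𝓝[<] 1) (𝓝 (Ψ f : EReal)) := by
      have h1 : Continuous fun t : ℝ => (Ψ (fun p => t * f p) : EReal) :=
        continuous_coe_real_ereal.comp (hΨ.comp (by fun_prop))
      have h2 := (h1.tendsto 1).mono_left (nhdsWithin_le_nhds (s := Set.Iio 1))
      simpa using h2
    refine le_of_tendsto hlim (Filter.eventually_of_mem (Ioo_mem_nhdsLT zero_lt_one) ?_)
    rintro t ⟨ht0, ht1⟩
    obtain ⟨g, hg, hgF⟩ := exists_costLip_eqOn_finset hsymm hc hr (f := fun p => t * f p) (by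
      intro p q hpq
      have h1 : |f p - f q| ≤ realCost c p q :=
        abs_le.2 ⟨by linarith [hf q p, realCost_comm hsymm p q], hf p q⟩
      rw [← mul_sub, abs_mul, abs_of_pos ht0]
      nlinarith [hpos p q hpq, abs_nonneg (f p - f q)]) F
    rw [← hF g _ hgF]
    exact le_iSup₂ (f := fun (g : S →ᵇ ℝ) (_ : g ∈ costLip c) => (Ψ g : EReal)) g hg

end Cost

/-! ### Finitely supported probability measures -/

section FiniteSupport

variable {S ι : Type*} [MeasurableSpace S]

lemma measure_compl_range_eq_zero [TopologicalSpace S] [HereditarilyLindelofSpace S]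
    {P : Measure S} {x : ι → S} (h : P.support = Set.range x) : P (Set.range x)ᶜ = 0 :=
  h ▸ Measure.measure_compl_support

variable [Fintype ι]

/-- The masses that a measure gives to the points `x i`. -/
noncomputable def pointWeights (P : Measure S) (x : ι → S) (i : ι) : ℝ := P.real {x i}

lemma eq_sum_smul_dirac [MeasurableSingletonClass S] {P : Measure S} {x : ι → S}
    (hx : Function.Injective x) (hP : P (Set.range x)ᶜ = 0) :
    P = ∑ i, P {x i} • Measure.dirac (x i) := by
  classical
  ext s hs
  have h1 : P s = P (s ∩ Set.range x) := (measure_inter_conull hP).symm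
  have h2 : s ∩ Set.range x = ⋃ i ∈ Finset.univ.filter fun i => x i ∈ s, {x i} := by
    ext p
    simp only [Set.mem_inter_iff, Set.mem_range, Finset.mem_filter, Finset.mem_univ, true_and,
      Set.mem_iUnion, Set.mem_singleton_iff, exists_prop]
    constructor
    · rintro ⟨hp, i, rfl⟩
      exact ⟨i, hp, rfl⟩
    · rintro ⟨i, hi, rfl⟩
      exact ⟨hi, i, rfl⟩
  rw [h1, h2, measure_biUnion_finset
    (fun i _ j _ hij => by simpa using fun h => hij (hx h)) fun i _ => measurableSet_singleton _]
  simp [Measure.finsetSum_apply, Measure.dirac_apply' _ hs, Set.indicator_apply, Finset.sum_filter]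

lemma integral_eq_weightedSum [MeasurableSingletonClass S] {P : Measure S} [IsFiniteMeasure P]
    {x : ι → S} (hx : Function.Injective x) (hP : P (Set.range x)ᶜ = 0) (f : S → ℝ) :
    ∫ p, f p ∂P = weightedSum (pointWeights P x) x f := by
  conv_lhs => rw [eq_sum_smul_dirac hx hP]
  rw [integral_finsetSum_measure fun i _ =>
    (integrable_dirac (by simp)).smul_measure (measure_ne_top P _)]
  simp [weightedSum, pointWeights, Measure.real]

lemma pointWeights_mem [MeasurableSingletonClass S] {P : Measure S} [IsProbabilityMeasure P]
    {x : ι → S} (hx : Function.Injective x) (hP : P (Set.range x)ᶜ = 0) :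
    pointWeights P x ∈ stdSimplex ℝ ι := by
  refine ⟨fun i => measureReal_nonneg, ?_⟩
  have := integral_eq_weightedSum hx hP fun _ => (1 : ℝ)
  simpa [weightedSum] using this.symm

lemma eq_of_pointWeights_eq [MeasurableSingletonClass S] {P P' : Measure S} [IsFiniteMeasure P]
    [IsFiniteMeasure P'] {x : ι → S} (hx : Function.Injective x) (hP : P (Set.range x)ᶜ = 0)
    (hP' : P' (Set.range x)ᶜ = 0) (h : pointWeights P x = pointWeights P' x) : P = P' := by
  rw [eq_sum_smul_dirac hx hP, eq_sum_smul_dirac hx hP']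
  refine Finset.sum_congr rfl fun i _ => ?_
  rw [(measureReal_eq_measureReal_iff (measure_ne_top P _) (measure_ne_top P' _)).1 (congrFun h i)]

lemma exists_probabilityMeasure_pointWeights_eq [MeasurableSingletonClass S] {x : ι → S}
    (hx : Function.Injective x) {w : ι → ℝ} (hw : w ∈ stdSimplex ℝ ι) {Q : Measure S}
    (hQ : ∀ i, Q {x i} ≠ 0) :
    ∃ P : ProbabilityMeasure S, (P : Measure S) ≪ Q ∧ pointWeights (P : Measure S) x = w := by
  classical
  refine ⟨⟨∑ i, ENNReal.ofReal (w i) • Measure.dirac (x i), ⟨?_⟩⟩, ?_, ?_⟩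
  · simp [Measure.finsetSum_apply, ← ENNReal.ofReal_sum_of_nonneg fun i _ => hw.1 i, hw.2]
  · refine Measure.AbsolutelyContinuous.mk fun s hs h0 => ?_
    rw [ProbabilityMeasure.coe_mk, Measure.finsetSum_apply]
    refine Finset.sum_eq_zero fun i _ => ?_
    have : x i ∉ s := fun hi => hQ i (measure_mono_null (Set.singleton_subset_iff.2 hi) h0)
    simp [Measure.dirac_apply' _ hs, this]
  · funext i
    simp [pointWeights, Measure.real, Measure.finsetSum_apply, Set.indicator_apply, hx.eq_iff,
      ENNReal.toReal_ofReal (hw.1 i)]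

lemma klDiv_eq_weightEntropy [MeasurableSingletonClass S] {P Q : Measure S} [IsFiniteMeasure P]
    [IsFiniteMeasure Q] {x : ι → S} (hx : Function.Injective x) (hQ : Q (Set.range x)ᶜ = 0)
    (hQ0 : ∀ i, 0 < pointWeights Q x i) (hPQ : P ≪ Q) :
    InformationTheory.klDiv P Q =
      ENNReal.ofReal (weightEntropy (pointWeights Q x) (pointWeights P x)) := by
  have hlint : ∀ f : S → ℝ≥0∞, ∫⁻ p, f p ∂Q = ∑ i, Q {x i} * f (x i) := by
    intro f
    conv_lhs => rw [eq_sum_smul_dirac hx hQ]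
    rw [lintegral_finsetSum_measure]
    simp
  have hdens : ∀ i, (P.rnDeriv Q (x i)).toReal = pointWeights P x i / pointWeights Q x i := by
    intro i
    rw [eq_div_iff (hQ0 i).ne', pointWeights, pointWeights, Measure.real, Measure.real,
      ← ENNReal.toReal_mul, ← lintegral_singleton, Measure.setLIntegral_rnDeriv hPQ]
  rw [InformationTheory.klDiv_eq_lintegral_klFun_of_ac hPQ, hlint, weightEntropy,
    ENNReal.ofReal_sum_of_nonneg fun i _ => mul_nonneg (hQ0 i).le
      (InformationTheory.klFun_nonneg (hdens i ▸ ENNReal.toReal_nonneg))]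
  refine Finset.sum_congr rfl fun i _ => ?_
  rw [hdens, ENNReal.ofReal_mul (hQ0 i).le,
    show ENNReal.ofReal (pointWeights Q x i) = Q {x i} from ofReal_measureReal]

lemma pointWeights_pos [TopologicalSpace S] [T1Space S] [HereditarilyLindelofSpace S]
    {P : Measure S} [IsFiniteMeasure P] {x : ι → S}
    (h : P.support = Set.range x) (i : ι) : 0 < pointWeights P x i := by
  -- Removing the other atoms leaves a neighbourhood of `x i`.
  have hU : (Set.range x \ {x i})ᶜ ∈ 𝓝 (x i) :=
    ((Set.finite_range x).sdiff.isClosed.isOpen_compl).mem_nhds (by simp)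
  have hpos := (Measure.mem_support_iff_forall (x i)).1 (h ▸ Set.mem_range_self i) _ hU
  have hle : P (Set.range x \ {x i})ᶜ ≤ P {x i} := by
    rw [← measure_inter_conull (measure_compl_range_eq_zero h)]
    refine measure_mono ?_
    rintro p ⟨h1, h2⟩
    by_contra h3
    exact h1 ⟨h2, h3⟩
  exact ENNReal.toReal_pos (hpos.trans_le hle).ne' (measure_ne_top P _)

end FiniteSupport

/-! ### The divergences of finitely supported measures -/

section Divergence

variable {S ι κ : Type*} [Fintype ι] [Fintype κ] [TopologicalSpace S] [MeasurableSpace S]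
  [BorelSpace S] [T1Space S] {c : S → S → ℝ≥0∞}

lemma gammaTransport_costLip_eq (hsymm : ∀ p q, c p q = c q p) (hc : ∀ p q, c p q ≠ ∞)
    (hr : CostRepresentable c) (hdet : MeasureDetermining (costLip c))
    {μ γ : ProbabilityMeasure S} {x : ι → S} {y : κ → S} (hx : Function.Injective x)
    (hy : Function.Injective y) (hγ : (γ : Measure S) (Set.range x)ᶜ = 0)
    (hμ : (μ : Measure S) (Set.range y)ᶜ = 0) (p₀ : S) :
    gammaTransport (costLip c) μ γ = ((weightTransport (realCost c) p₀ (pointWeights (μ : Measure S) y)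
      y x (pointWeights (γ : Measure S) x) : ℝ) : EReal) := by
  classical
  have hgr := isGreatest_weightTransport (realCost_nonneg (c := c)) p₀ (pointWeights_mem hy hμ).2
    (pointWeights_mem hx hγ).2 y x
  obtain ⟨f, hf, hfe⟩ := hgr.1
  rw [← hfe]
  simp only [gammaTransport, integral_eq_weightedSum hx hγ, integral_eq_weightedSum hy hμ]
  refine iSup_costLip_eq hsymm hc hr (fun p q => realCost_pos hsymm hc hdet)
    (Ψ := potentialGap (pointWeights (μ : Measure S) y) y x (pointWeights (γ : Measure S) x))
    ((continuous_potentialGap _ y x).comp (Continuous.prodMk_right _))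
    (Finset.univ.image x ∪ Finset.univ.image y) (fun g k hgk => ?_) hf
    fun g hg => (hgr.2 ⟨g, hg, rfl⟩).trans_eq hfe.symm
  simp only [potentialGap]
  rw [weightedSum_congr fun i => hgk (y i) (by simp), weightedSum_congr fun i => hgk (x i) (by simp)]

lemma gammaDivergence_smul_costLip_eq [Nonempty ι] (hsymm : ∀ p q, c p q = c q p)
    (hc : ∀ p q, c p q ≠ ∞) (hr : CostRepresentable c) (hdet : MeasureDetermining (costLip c))
    {μ ν : ProbabilityMeasure S} {x : ι → S} {y : κ → S} (hx : Function.Injective x)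
    (hy : Function.Injective y) (hν : (ν : Measure S) (Set.range x)ᶜ = 0)
    (hν0 : ∀ i, 0 < pointWeights (ν : Measure S) x i)
    (hμ : (μ : Measure S) (Set.range y)ᶜ = 0) {b : ℝ} {f : S → ℝ}
    (hf : f ∈ lipPotentials (realCost c))
    (hmax : ∀ g ∈ lipPotentials (realCost c),
      divergenceObjective (pointWeights (μ : Measure S) y) y (pointWeights (ν : Measure S) x) x b g ≤
      divergenceObjective (pointWeights (μ : Measure S) y) y (pointWeights (ν : Measure S) x) x b f) :
    gammaDivergence (b • costLip c) μ ν = ((divergenceObjective (pointWeights (μ : Measure S) y) y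
      (pointWeights (ν : Measure S) x) x b f : ℝ) : EReal) := by
  classical
  rw [gammaDivergence, ← Set.image_smul, iSup_image,
    ← iSup_costLip_eq hsymm hc hr (fun p q => realCost_pos hsymm hc hdet)
    (continuous_divergenceObjective _ y hν0 x b)
    (Finset.univ.image x ∪ Finset.univ.image y) (fun g k hgk => ?_) hf hmax]
  · simp only [integral_eq_weightedSum hx hν, integral_eq_weightedSum hy hμ, divergenceObjective,
      BoundedContinuousFunction.coe_smul, smul_eq_mul, weightedSum_mul_left]
  · simp only [divergenceObjective]
    rw [weightedSum_congr fun i => hgk (y i) (by simp),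
      weightedSum_congr (x := x) (f := fun p => Real.exp (b * g p))
        (g := fun p => Real.exp (b * k p)) fun i => by
        rw [hgk (x i) (by simp)]]

end Divergence

/-! ### The expansion of the divergence and its limit measure -/

theorem mainTheorem8 {S : Type*} [TopologicalSpace S] [PolishSpace S]
    [MeasurableSpace S] [BorelSpace S]
    (c : S → S → ℝ≥0∞) (hc_symm : ∀ x y, c x y = c y x)
    (hc_repr : CostRepresentable c)
    (hc_det : MeasureDetermining (costLip c))
    (hc_fin : ∃ a : S → ℝ≥0, ∀ x y, c x y ≤ (a x : ℝ≥0∞) + (a y : ℝ≥0∞))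
    (μ ν : ProbabilityMeasure S) {N M : ℕ} (x : Fin N → S) (y : Fin M → S)
    (hx : Function.Injective x) (hy : Function.Injective y)
    (hν : (ν : Measure S).support = Set.range x)
    (hμ : (μ : Measure S).support = Set.range y) :
    ∃ γ : ProbabilityMeasure S,
      (γ : Measure S) ≪ (ν : Measure S) ∧
      gammaTransport (costLip c) μ γ ≠ ⊤ ∧
      relEntropy γ ν ≠ ⊤ ∧
      (∃ r : ℝ → ℝ, (∀ b : ℝ, 0 < b → r b ≤ 0) ∧ Tendsto r atTop (𝓝 0) ∧
        ∀ b : ℝ, 0 < b →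
          gammaDivergence (b • costLip c) μ ν =
            (b : EReal) * gammaTransport (costLip c) μ γ + (relEntropy γ ν : EReal)
              + (r b : EReal)) ∧
      (∀ γ' : ProbabilityMeasure S,
        IsConstrainedEntropyMinimizer (costLip c) μ ν γ' ↔ γ' = γ) ∧
      ((∀ (j : Fin M) (i l : Fin N), i ≠ l → c (y j) (x i) ≠ c (y j) (x l)) →
        ∀ i : Fin N, (γ : Measure S) {x i} =
          ∑ j ∈ nearestIndices c x y i, (μ : Measure S) {y j}) := by
  have hc : ∀ p q, c p q ≠ ∞ := by
    obtain ⟨a, ha⟩ := hc_fin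
    exact fun p q => ((ha p q).trans_lt (by simp)).ne
  have hν0 := measure_compl_range_eq_zero hν
  have hμ0 := measure_compl_range_eq_zero hμ
  set n := pointWeights (ν : Measure S) x with hn
  set m := pointWeights (μ : Measure S) y with hm
  have hn0 : ∀ i, 0 < n i := pointWeights_pos hν
  have hn1 : n ∈ stdSimplex ℝ (Fin N) := pointWeights_mem hx hν0
  have hm1 : m ∈ stdSimplex ℝ (Fin M) := pointWeights_mem hy hμ0
  have hne : Nonempty (Fin N) := by
    obtain ⟨p, hp⟩ := Measure.nonempty_support (IsProbabilityMeasure.ne_zero (ν : Measure S))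
    rw [hν] at hp
    exact ⟨hp.choose⟩
  obtain ⟨i₀⟩ := id hne
  have hd : ∀ p q, 0 ≤ realCost c p q := realCost_nonneg
  set T := weightTransport (realCost c) (x i₀) m y x with hT
  set H := weightEntropy n with hH
  have hTc : Continuous T := continuous_weightTransport _ _ m y x
  have hHc : Continuous H := continuous_weightEntropy n
  have hK : IsCompact (stdSimplex ℝ (Fin N)) := isCompact_stdSimplex ℝ (Fin N)
  -- The weights of the limit measure: least entropy among the least transport costs.
  obtain ⟨w, hw, hwT, hwH⟩ := hK.exists_lexicographic_min ⟨n, hn1⟩ hTc hHc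
  have huniq : ∀ v ∈ stdSimplex ℝ (Fin N), T v ≤ T w → H v ≤ H w → v = w := by
    intro v hv hvT hvH
    by_contra hvw
    have hmid : (fun i => (v i + w i) / 2) ∈ stdSimplex ℝ (Fin N) := by
      refine ⟨fun i => by linarith [hv.1 i, hw.1 i], ?_⟩
      rw [← Finset.sum_div, Finset.sum_add_distrib, hv.2, hw.2]
      norm_num
    have h1 := weightEntropy_midpoint_lt hn0 hv.1 hw.1 hvw
    have h2 := weightTransport_midpoint_le hd (x i₀) hm1.2 hv.2 hw.2 y x
    have h3 := hwH _ hmid (by linarith)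
    linarith
  obtain ⟨γ, hγν, hγw⟩ := exists_probabilityMeasure_pointWeights_eq hx hw
    (Q := (ν : Measure S)) fun i h => (hn0 i).ne' (by simp [hn, pointWeights, Measure.real, h])
  have hac : ∀ θ : ProbabilityMeasure S, (θ : Measure S) ≪ (ν : Measure S) →
      pointWeights (θ : Measure S) x ∈ stdSimplex ℝ (Fin N) ∧
      gammaTransport (costLip c) μ θ = (T (pointWeights (θ : Measure S) x) : EReal) ∧
      relEntropy θ ν = ENNReal.ofReal (H (pointWeights (θ : Measure S) x)) := fun θ hθ =>
    ⟨pointWeights_mem hx (hθ hν0),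
      gammaTransport_costLip_eq hc_symm hc hc_repr hc_det hx hy (hθ hν0) hμ0 (x i₀),
      klDiv_eq_weightEntropy hx hν0 hn0 hθ⟩
  obtain ⟨-, hγT, hγH⟩ := hac γ hγν
  rw [hγw] at hγT hγH
  have hH0 : ∀ v ∈ stdSimplex ℝ (Fin N), 0 ≤ H v := fun v hv => weightEntropy_nonneg hn0 hv.1
  have hinf : (⨅ θ : ProbabilityMeasure S, ⨅ _ : (θ : Measure S) ≪ (ν : Measure S),
      gammaTransport (costLip c) μ θ) = (T w : EReal) := by
    refine le_antisymm ((iInf₂_le γ hγν).trans_eq hγT) (le_iInf₂ fun θ hθ => ?_)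
    obtain ⟨h1, h2, -⟩ := hac θ hθ
    rw [h2]
    exact_mod_cast hwT _ h1
  have hdual := fun b (hb : 0 < b) =>
    exists_divergenceObjective_eq hd (x i₀) hm1.2 y hn0 hn1.2 x (b := b) hb
  -- `f b` is a maximizing potential for the parameter `b`, and `v b` are the weights dual to it.
  choose! f hf hfmax v hv hfv using hdual
  have hG : ∀ b, 0 < b → gammaDivergence (b • costLip c) μ ν =
      ((divergenceObjective m y n x b (f b) : ℝ) : EReal) := fun b hb =>
    gammaDivergence_smul_costLip_eq hc_symm hc hc_repr hc_det hx hy hν0 hn0 hμ0 (hf b hb)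
      (hfmax b hb)
  have hupper : ∀ b, 0 < b → divergenceObjective m y n x b (f b) ≤ b * T w + H w := by
    intro b hb
    have h1 := divergenceObjective_le (m := m) y hn0 hn1.2 hw x b (f b)
    have h2 := (isGreatest_weightTransport hd (x i₀) hm1.2 hw.2 y x).2 ⟨f b, hf b hb, rfl⟩
    linarith [mul_le_mul_of_nonneg_left h2 hb.le]
  refine ⟨γ, hγν, by simp [hγT], by simp [hγH],
    ⟨fun b => divergenceObjective m y n x b (f b) - b * T w - H w, ?_, ?_, ?_⟩, ?_, ?_⟩
  · intro b hb
    linarith [hupper b hb]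
  · rw [Metric.tendsto_atTop']
    intro ε hε
    have hev := hK.eventually_lt_of_penalized hTc hHc hH0 hwH hv
      (fun b hb => (hfv b hb).symm.trans_le (hupper b hb)) hε
    obtain ⟨B, hB⟩ := eventually_atTop.1 (hev.and (eventually_gt_atTop 0))
    refine ⟨B, fun b hb => ?_⟩
    obtain ⟨h1, h2⟩ := hB b hb.le
    have h3 := hupper b h2
    have h4 := mul_le_mul_of_nonneg_left (hwT _ (hv b h2)) h2.le
    rw [Real.dist_eq, sub_zero, abs_lt]
    constructor <;> linarith [hfv b h2]
  · intro b hb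
    rw [hG b hb, hγT, hγH, EReal.coe_ennreal_ofReal, max_eq_left (hH0 w hw)]
    norm_cast
    ring
  · have hγmin : IsConstrainedEntropyMinimizer (costLip c) μ ν γ := by
      refine ⟨hγT.trans hinf.symm, fun γ' hγ' => ?_⟩
      by_cases hγ'ν : (γ' : Measure S) ≪ (ν : Measure S)
      · obtain ⟨h1, h2, h3⟩ := hac γ' hγ'ν
        rw [AttainsTransportInf, hinf, h2] at hγ'
        rw [hγH, h3]
        exact ENNReal.ofReal_le_ofReal (hwH _ h1 (by exact_mod_cast hγ'.le))
      -- A measure that is not absolutely continuous has infinite entropy.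
      · exact le_top.trans_eq (InformationTheory.klDiv_of_not_ac hγ'ν).symm
    refine fun γ' => ⟨fun hγ' => ?_, fun h => h ▸ hγmin⟩
    have hle := hγ'.2 γ hγmin.1
    have hγ'ν : (γ' : Measure S) ≪ (ν : Measure S) := by
      by_contra hcon
      rw [hγH, relEntropy, InformationTheory.klDiv_of_not_ac hcon] at hle
      exact ENNReal.ofReal_ne_top (top_le_iff.1 hle)
    obtain ⟨h1, h2, h3⟩ := hac γ' hγ'ν
    have hγ'T := hγ'.1
    rw [AttainsTransportInf, hinf, h2] at hγ'T
    rw [hγH, h3, ENNReal.ofReal_le_ofReal_iff (hH0 w hw)] at hle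
    have := huniq _ h1 (by exact_mod_cast hγ'T.le) hle
    exact ProbabilityMeasure.toMeasure_injective
      (eq_of_pointWeights_eq hx (hγ'ν hν0) (hγν hν0) (this.trans hγw.symm))
  · intro hdist i
    have hnear : ∀ j, ∃ i, ∀ l, c (y j) (x i) ≤ c (y j) (x l) := fun j =>
      Finite.exists_min fun l => c (y j) (x l)
    choose σ hσ using hnear
    have hσlt : ∀ j l, l ≠ σ j → realCost c (y j) (x (σ j)) < realCost c (y j) (x l) := fun j l hl =>
      (ENNReal.toReal_lt_toReal (hc _ _) (hc _ _)).2
        ((hσ j l).lt_of_ne (hdist j (σ j) l hl.symm))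
    have hwσ : w = pushWeights m σ :=
      eq_pushWeights_of_weightTransport_le hd (realCost_self hc hc_repr)
        (realCost_triangle hc hc_repr) (x i₀) hm1 y x
        (fun i l hil => realCost_pos hc_symm hc hc_det (hx.ne hil)) hσlt hw.2
        (hwT _ (pushWeights_mem hm1 σ))
    have hind : nearestIndices c x y i = Finset.univ.filter fun j => σ j = i := by
      ext j
      simp only [nearestIndices, Finset.mem_filter, Finset.mem_univ, true_and]
      refine ⟨fun h => ?_, fun h => h ▸ hσ j⟩
      by_contra hne'
      exact hdist j (σ j) i hne' ((hσ j i).antisymm (h (σ j)))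
    have hreal : (γ : Measure S).real {x i} = ∑ j ∈ nearestIndices c x y i, m j := by
      rw [hind]
      exact ((congrFun hγw i).trans (congrFun hwσ i)).trans (Finset.sum_congr (by congr) fun _ _ => rfl)
    rw [← ofReal_measureReal, hreal, ENNReal.ofReal_sum_of_nonneg fun j _ => hm1.1 j]
    exact Finset.sum_congr rfl fun j _ => ofReal_measureReal
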